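/- **Setting.** All Hilbert spaces are finite-dimensional. Let $n,m\ge 0$ and let $\mathcal H_A=(\mathbb C^2)^{\otimes n}$ have the bit basis $|z\rangle$, $z\in\{0,1\}^n$. Arithmetic of bit strings is modulo 2. For $x,e\in\{0,1\}^n$ put $Z^e|z\rangle=(-1)^{e\cdot z}|z\rangle$, $X^x|z\rangle=|z+x\rangle$ and $|\widetilde x\rangle=2^{-n/2}\sum_z(-1)^{x\cdot z}|z\rangle$. A positive semidefinite operator is sub-normalized if its trace is at most $1$, and normalized if its trace is $1$. *Initial state.* Let $\rho_{AE}=\sum_{a\in\{0,1\}^n}|a\rangle\langle a|_A\otimes\rho_E^a$ be a nonzero sub-normalized classical-quantum state (every $\rho_E^a\ge0$), and let $|\Psi\rangle_{AEA'}$ be any purification of it, i.e. $\mathrm{Tr}_{A'}|\Psi\rangle\langle\Psi|=\rho_{AE}$. The conditional min-entropy $H_{\min}(\rho_{AE}|E)$ is the supremum (in fact maximum) of the real numbers $\lambda$ such that $2^{-\lambda}\,\mathbb I_A\otimes\sigma_E\ge\rho_{AE}$ for some normalized state $\sigma_E$. *Hash functions.* Let $G$ be a random function taking values, with probabilities $\Pr(G=g)$,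 in a finite family of linear surjective maps $g:\{0,1\}^n\to\{0,1\}^m$. It is universal$_2$ if $\Pr(G(a)=G(a'))\le 2^{-m}$ for all $a\ne a'$. For each $g$ of the family fix a check matrix $h^g$ of the code $C^g=(\ker g)^\perp$: an $(n-m)\times n$ binary matrix, with rows $h^g_1,\dots,h^g_{n-m}$, whose kernel is $C^g$. *Phase error correction.* For each $g$ of the family and each $s\in\{0,1\}^{n-m}$ let $M^{g,s}=\{E^{g,s,e}_{A'}\mid e\in\{0,1\}^n\}$ be operators on $\mathcal H_{A'}$ with $\sum_e E^{g,s,e\,\dagger}E^{g,s,e}=\mathbb I_{A'}$. The operation $\Pi^{\mathrm{pec},g}$ measures in $\mathcal H_A$ the eigenvalues $(-1)^{s_j}$ of the commuting operators $X^{h^g_j}$, $j=1,\dots,n-m$, then measures $\mathcal H_{A'}$ with $M^{g,s}$, obtaining $e$, and applies $Z^e$ to $\mathcal H_A$. That is, with $P^g_s=\prod_j\tfrac12\bigl(\mathbb I+(-1)^{s_j}X^{h^g_j}\bigr)$, $$\rho^{\mathrm{pec},g}=\sum_{s,e}\bigl(Z^eP^g_s\otimes\mathbb I_E\otimes E^{g,s,e}\bigr)\,|\Psi\rangle\langle\Psi|\,\bigl(Z^eP^g_s\otimes\mathbb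 I_E\otimes E^{g,s,e}\bigr)^\dagger .$$ Its failure probability (phase error probability) is $$P^{\mathrm{ph}}_A(\rho^{\mathrm{pec},g})=\mathrm{Tr}\,\rho^{\mathrm{pec},g}_A-\langle\widetilde 0|\rho^{\mathrm{pec},g}_A|\widetilde 0\rangle,\qquad \rho_A^{\mathrm{pec},g}=\mathrm{Tr}_{EA'}\,\rho^{\mathrm{pec},g},$$ which is $1-\langle\widetilde 0|\rho^{\mathrm{pec},g}_A|\widetilde 0\rangle$ when $\rho_{AE}$ is normalized. **Theorem (coding theorem of the quantum phase error correction).** If $G$ is universal$_2$, then the ancilla measurements $M^{g,s}$ can be chosen such that $$\sum_g\Pr(G=g)\,P^{\mathrm{ph}}_A\bigl(\rho^{\mathrm{pec},g}\bigr)\le 2^{\,m-H_{\min}(\rho_{AE}|E)} .$$ -/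

import Mathlib

open scoped Matrix Kronecker ComplexOrder

noncomputable section

namespace PhaseEC

/-- Bit strings of length `d`, with arithmetic modulo 2. The `d`-qubit space is `ℂ^(Bits d)`,
whose standard basis is the bit basis `|z⟩`. -/
abbrev Bits (d : ℕ) : Type := Fin d → ZMod 2

/-- The sign `(-1)^b` of a bit. -/
def sgn (b : ZMod 2) : ℂ := (-1) ^ b.val

/-- `Z^e`, with `Z^e |z⟩ = (-1)^(e·z) |z⟩`. -/
def pauliZ {d : ℕ} (e : Bits d) : Matrix (Bits d) (Bits d) ℂ :=
  Matrix.diagonal fun z => sgn (e ⬝ᵥ z)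

/-- `X^x`, with `X^x |z⟩ = |z + x⟩`. -/
def pauliX {d : ℕ} (x : Bits d) : Matrix (Bits d) (Bits d) ℂ :=
  Matrix.of fun i j => if i = j + x then 1 else 0

/-- The phase basis vector `2^(-d/2) ∑_z (-1)^(x·z) |z⟩`. -/
def phaseKet {d : ℕ} (x : Bits d) : Bits d → ℂ :=
  fun z => (((Real.sqrt (2 ^ d))⁻¹ : ℝ) : ℂ) * sgn (x ⬝ᵥ z)

/-- The operator `|ψ⟩⟨ψ|`. -/
def ketbra {ι : Type*} (ψ : ι → ℂ) : Matrix ι ι ℂ :=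
  Matrix.vecMulVec ψ (star ψ)

/-- Partial trace over the second tensor factor. -/
def ptrace {ι κ : Type*} [Fintype κ] (ρ : Matrix (ι × κ) (ι × κ) ℂ) : Matrix ι ι ℂ :=
  Matrix.of fun i j => ∑ k, ρ (i, k) (j, k)

/-- Positive semidefinite with trace at most one. -/
def IsSubnormalized {ι : Type*} [Fintype ι] (ρ : Matrix ι ι ℂ) : Prop :=
  ρ.PosSemidef ∧ ρ.trace.re ≤ 1

/-- Positive semidefinite with trace one. -/
def IsNormalized {ι : Type*} [Fintype ι] (ρ : Matrix ι ι ℂ) : Prop :=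
  ρ.PosSemidef ∧ ρ.trace = 1

/-- Classical-quantum: `ρ = ∑_a |a⟩⟨a| ⊗ ρ^a` with every `ρ^a` positive semidefinite. -/
def IsCQ {n : ℕ} {E : Type*} [Fintype E]
    (ρ : Matrix (Bits n × E) (Bits n × E) ℂ) : Prop :=
  ∃ r : Bits n → Matrix E E ℂ, (∀ a, (r a).PosSemidef) ∧
    ρ = ∑ a, Matrix.single a a (1 : ℂ) ⊗ₖ r a

/-- `Ψ` in `A ⊗ E ⊗ A'` is a purification of `ρ` in `A ⊗ E`. -/
def IsPurification {ι κ : Type*} [Fintype κ] (Ψ : ι × κ → ℂ) (ρ : Matrix ι ι ℂ) : Prop :=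
  ptrace (ketbra Ψ) = ρ

/-- The real numbers `l` with `2^(-l) 𝟙_A ⊗ σ_E ≥ ρ_AE` for some normalized state `σ_E`. -/
def minEntropySet {A E : Type*} [Fintype A] [DecidableEq A] [Fintype E]
    (ρ : Matrix (A × E) (A × E) ℂ) : Set ℝ :=
  {l : ℝ | ∃ σ : Matrix E E ℂ, IsNormalized σ ∧
    ((((2 : ℝ) ^ (-l) : ℝ) : ℂ) • ((1 : Matrix A A ℂ) ⊗ₖ σ) - ρ).PosSemidef}

/-- The conditional min-entropy `H_min(ρ_AE|E)`. The set is nonempty and bounded above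
whenever `ρ` is positive semidefinite and nonzero. -/
def minEntropy {A E : Type*} [Fintype A] [DecidableEq A] [Fintype E]
    (ρ : Matrix (A × E) (A × E) ℂ) : ℝ :=
  sSup (minEntropySet ρ)

/-- A random hash function: a family of surjective linear functions `{0,1}^n → {0,1}^m`
together with a probability distribution on it. -/
structure RandomHash (n m : ℕ) where
  family : Finset (Bits n →ₗ[ZMod 2] Bits m)
  prob : (Bits n →ₗ[ZMod 2] Bits m) → ℝ
  prob_nonneg : ∀ g ∈ family, 0 ≤ prob g
  prob_sum : ∑ g ∈ family, prob g = 1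
  surjective : ∀ g ∈ family, Function.Surjective g

/-- Universal₂: distinct inputs collide with probability at most `2^(-m)`. -/
def RandomHash.IsUniversal₂ {n m : ℕ} (G : RandomHash n m) : Prop :=
  ∀ a a' : Bits n, a ≠ a' →
    ∑ g ∈ G.family, G.prob g * (if g a = g a' then 1 else 0) ≤ ((2 : ℝ) ^ m)⁻¹

/-- The classical code `C^g = (ker g)^⊥`. -/
def code {n m : ℕ} (g : Bits n →ₗ[ZMod 2] Bits m) : Set (Bits n) :=
  {x | ∀ a : Bits n, g a = 0 → x ⬝ᵥ a = 0}

/-- `h` is a check matrix of the code `C`: `C` is its kernel. For a code of dimension `m` and a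
matrix with `n - m` rows this forces the rows to be linearly independent. -/
def IsCheckMatrix {n r : ℕ} (h : Matrix (Fin r) (Fin n) (ZMod 2)) (C : Set (Bits n)) : Prop :=
  ∀ x : Bits n, x ∈ C ↔ h *ᵥ x = 0

/-- The operator of the syndrome measurement with outcome `s`: the product over `j` of the
projections `(𝟙 + (-1)^(s_j) X^(h_j)) / 2` onto the eigenspace of the syndrome operator `X^(h_j)`
with eigenvalue `(-1)^(s_j)`. The factors commute. -/
def syndromeProj {n r : ℕ} (h : Matrix (Fin r) (Fin n) (ZMod 2)) (s : Bits r) :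
    Matrix (Bits n) (Bits n) ℂ :=
  (List.ofFn fun j => (2⁻¹ : ℂ) • (1 + sgn (s j) • pauliX (h j))).prod

/-- A measurement on the ancilla space with outcomes `e ∈ {0,1}^n`: `∑_e (E^e)† E^e = 𝟙`. -/
def IsMeasurement {n : ℕ} {A' : Type*} [Fintype A'] [DecidableEq A']
    (M : Bits n → Matrix A' A' ℂ) : Prop :=
  ∑ e, (M e)ᴴ * M e = 1

/-- The phase error correction as a map on operators of `(A ⊗ E) ⊗ A'`: syndrome measurement in
`A` with check matrix `h`, giving `s`; ancilla measurement `M s` in `A'`, giving `e`; phase flip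
`Z^e` in `A`. The outcomes are summed over. -/
def pec {n r : ℕ} {E A' : Type*} [Fintype E] [DecidableEq E] [Fintype A']
    (h : Matrix (Fin r) (Fin n) (ZMod 2)) (M : Bits r → Bits n → Matrix A' A' ℂ)
    (ρ : Matrix ((Bits n × E) × A') ((Bits n × E) × A') ℂ) :
    Matrix ((Bits n × E) × A') ((Bits n × E) × A') ℂ :=
  ∑ s : Bits r, ∑ e : Bits n,
    (((pauliZ e * syndromeProj h s) ⊗ₖ (1 : Matrix E E ℂ)) ⊗ₖ M s e) * ρ *
      (((pauliZ e * syndromeProj h s) ⊗ₖ (1 : Matrix E E ℂ)) ⊗ₖ M s e)ᴴ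

/-- The phase error probability of an operator on the `n`-qubit space: the weight
`Tr ρ - ⟨0~|ρ|0~⟩` of all phases other than `0`. -/
def phaseErrorProb {n : ℕ} (ρ : Matrix (Bits n) (Bits n) ℂ) : ℝ :=
  (ρ.trace - star (phaseKet 0) ⬝ᵥ (ρ *ᵥ phaseKet 0)).re

/-- For a normalized state the phase error probability is `1 - ⟨0~|ρ|0~⟩`. -/
theorem phaseErrorProb_of_trace_eq_one {n : ℕ} (ρ : Matrix (Bits n) (Bits n) ℂ)
    (h : ρ.trace = 1) :
    phaseErrorProb ρ = 1 - (star (phaseKet 0) ⬝ᵥ (ρ *ᵥ phaseKet 0)).re := by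
  simp [phaseErrorProb, h]

end PhaseEC

end

/-!
Write `∑ a, q a = R ^ 4` for the blocks `q a` of `ρ`, and `T a` for the components of `Ψ`.

The code `(ker g)^⊥` is the range of the transpose of `g`, so the phases compatible with a syndrome
form a coset `x + gᵀ y`. Along this coset the phase components of `Ψ` are the Fourier transform in
`y` of the vectors `Φ k = ∑ (-1)^(x·a) T a`, summed over `g a = k`, which purify the ensemble of
hash values `Q k = ∑ q a`. The Fourier transform of the square-root decoder of `Q` is therefore a
measurement that identifies the phase. Its overlap with every phase component is proportional to
`S = ∑ k, U k * R`, where `U k` is the square root of `R⁻¹ * Q k * R⁻¹`, and its success probability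
is `2^(-m) tr (Sᴴ * S)`.

The scalar inequality `3 u² r² ≤ c² u⁴ + 2 c⁻¹ u r³`, applied at `c² = 2^m` to the spectra of `U k`
and `R`, and Young's inequality `2 tr (R² * S) ≤ c tr R⁴ + c⁻¹ tr (Sᴴ * S)` bound the failure
probability by `2^m ∑ k, tr (R⁻¹ * Q k * R⁻¹)² - tr R⁴`. The subtracted term is exactly the
contribution of the collisions that universality allows, so the average over `g` is at most
`2^m ∑ a, tr (R⁻¹ * q a * R⁻¹)²`. This sum, the pretty good collision probability, is at most
`2^(-l)` whenever `q a ≤ 2^(-l) σ` for all `a`.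
-/

noncomputable section

namespace PhaseEC

open scoped MatrixOrder

section FunctionalCalculus

variable {ι κ : Type*} [Fintype ι] [DecidableEq ι] {A B : Matrix ι ι ℂ}

theorem continuousOn_spectrum (A : Matrix ι ι ℂ) (f : ℝ → ℝ) : ContinuousOn f (spectrum ℝ A) :=
  A.finite_real_spectrum.continuousOn f

theorem cfc_mul_cfc (A : Matrix ι ι ℂ) (f g : ℝ → ℝ) :
    cfc f A * cfc g A = cfc (fun x => f x * g x) A :=
  (cfc_mul f g A (continuousOn_spectrum A f) (continuousOn_spectrum A g)).symm

/-- The Moore–Penrose inverse of a Hermitian matrix: every nonzero eigenvalue is inverted, the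
eigenvalue `0` is kept. -/
def pinv (A : Matrix ι ι ℂ) : Matrix ι ι ℂ := cfc (fun x : ℝ => x⁻¹) A

/-- The projection onto the range of a Hermitian matrix. -/
def supportProj (A : Matrix ι ι ℂ) : Matrix ι ι ℂ := A * pinv A

theorem conjTranspose_pinv (A : Matrix ι ι ℂ) : (pinv A)ᴴ = pinv A :=
  (cfc_predicate (fun x : ℝ => x⁻¹) A : IsSelfAdjoint _)

theorem supportProj_eq_cfc (hA : A.IsHermitian) :
    supportProj A = cfc (fun x : ℝ => x * x⁻¹) A := by
  rw [← cfc_mul_cfc, cfc_id' ℝ A hA.isSelfAdjoint, supportProj, pinv]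

theorem pinv_mul_self (hA : A.IsHermitian) : pinv A * A = supportProj A := by
  have hcomm : Commute (pinv A) (cfc (fun x : ℝ => x) A) := cfc_commute_cfc _ _ A
  rwa [cfc_id' ℝ A hA.isSelfAdjoint] at hcomm

theorem supportProj_mul_self (hA : A.IsHermitian) : supportProj A * A = A := by
  nth_rw 2 3 [← cfc_id' ℝ A hA.isSelfAdjoint]
  simp only [supportProj_eq_cfc hA, cfc_mul_cfc, mul_inv_mul_cancel]

theorem self_mul_supportProj (hA : A.IsHermitian) : A * supportProj A = A := by
  rw [← pinv_mul_self hA, ← Matrix.mul_assoc, ← supportProj, supportProj_mul_self hA]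

theorem supportProj_mul_pinv (hA : A.IsHermitian) : supportProj A * pinv A = pinv A := by
  rw [supportProj_eq_cfc hA, pinv, cfc_mul_cfc]
  congr with x
  rcases eq_or_ne x 0 with rfl | hx <;> simp [*]

theorem isStarProjection_supportProj (hA : A.IsHermitian) : IsStarProjection (supportProj A) where
  isIdempotentElem := by
    change supportProj A * (A * pinv A) = A * pinv A
    rw [← Matrix.mul_assoc, supportProj_mul_self hA]
  isSelfAdjoint := by
    rw [supportProj_eq_cfc hA]
    exact cfc_predicate _ A

omit [DecidableEq ι] in
theorem mul_eq_zero_of_le {C : Matrix ι ι ℂ} (hB : B.PosSemidef) (hBA : B ≤ A) (hCA : C * A = 0) :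
    C * B = 0 := by
  classical
  have hle : C * B * Cᴴ ≤ 0 := by
    have h := Matrix.PosSemidef.mul_mul_conjTranspose_same hBA C
    rwa [Matrix.mul_sub, Matrix.sub_mul, hCA, Matrix.zero_mul, ← Matrix.le_iff] at h
  have hzero : C * B * Cᴴ = 0 := hle.antisymm (hB.mul_mul_conjTranspose_same C).nonneg
  obtain ⟨D, rfl⟩ := CStarAlgebra.nonneg_iff_eq_mul_star_self.mp hB.nonneg
  have hCD : C * D = 0 := by
    rw [← Matrix.self_mul_conjTranspose_eq_zero, Matrix.conjTranspose_mul, ← hzero]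
    simp only [Matrix.mul_assoc, Matrix.star_eq_conjTranspose]
  rw [← Matrix.mul_assoc, hCD, Matrix.zero_mul]

theorem supportProj_mul_of_le_pow (hA : A.IsHermitian) (hB : B.PosSemidef) {k : ℕ} (hk : k ≠ 0)
    (hBA : B ≤ A ^ k) : supportProj A * B = B := by
  have hker : (1 - supportProj A) * A ^ k = 0 := by
    obtain ⟨l, rfl⟩ := Nat.exists_eq_succ_of_ne_zero hk
    rw [pow_succ', ← Matrix.mul_assoc, Matrix.sub_mul, Matrix.one_mul, supportProj_mul_self hA,
      sub_self, Matrix.zero_mul]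
  have h := mul_eq_zero_of_le hB hBA hker
  rw [Matrix.sub_mul, Matrix.one_mul, sub_eq_zero] at h
  exact h.symm

theorem trace_cfc_mul_cfc (hA : A.IsHermitian) (hB : B.IsHermitian) (f g : ℝ → ℝ) :
    (cfc f A * cfc g B).trace = ∑ i, ∑ j, ((f (hA.eigenvalues i) * g (hB.eigenvalues j) *
      Complex.normSq ((star (hA.eigenvectorUnitary : Matrix ι ι ℂ) * hB.eigenvectorUnitary) i j)
        : ℝ) : ℂ) := by
  set U := (hA.eigenvectorUnitary : Matrix ι ι ℂ)
  set V := (hB.eigenvectorUnitary : Matrix ι ι ℂ)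
  set W := star U * V with hW
  have hdiag : (cfc f A * cfc g B).trace =
      (Matrix.diagonal (fun i => (f (hA.eigenvalues i) : ℂ)) * W *
        (Matrix.diagonal (fun j => (g (hB.eigenvalues j) : ℂ)) * star W)).trace := by
    rw [hA.cfc_eq, hB.cfc_eq, Matrix.IsHermitian.cfc, Matrix.IsHermitian.cfc]
    simp only [Unitary.conjStarAlgAut_apply]
    rw [hW, star_mul, star_star]
    simp only [Matrix.mul_assoc]
    rw [Matrix.trace_mul_comm]
    simp only [Matrix.mul_assoc]
    rfl
  rw [hdiag, Matrix.trace]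
  refine Finset.sum_congr rfl fun i _ => ?_
  rw [Matrix.diag_apply, Matrix.mul_apply]
  refine Finset.sum_congr rfl fun j _ => ?_
  rw [Matrix.diagonal_mul, Matrix.diagonal_mul, Matrix.star_apply]
  push_cast
  rw [Complex.normSq_eq_conj_mul_self, starRingEnd_apply]
  ring

theorem sum_re_trace_cfc_mul_cfc_nonneg (hA : A.IsHermitian) (hB : B.IsHermitian) (s : Finset κ)
    (f g : κ → ℝ → ℝ)
    (h : ∀ x ∈ spectrum ℝ A, ∀ y ∈ spectrum ℝ B, 0 ≤ ∑ k ∈ s, f k x * g k y) :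
    0 ≤ ∑ k ∈ s, (cfc (f k) A * cfc (g k) B).trace.re := by
  simp only [trace_cfc_mul_cfc hA hB, Complex.re_sum, Complex.ofReal_re]
  rw [Finset.sum_comm]
  refine Finset.sum_nonneg fun i _ => ?_
  rw [Finset.sum_comm]
  refine Finset.sum_nonneg fun j _ => ?_
  rw [← Finset.sum_mul]
  exact mul_nonneg (h _ (hA.eigenvalues_mem_spectrum_real i) _ (hB.eigenvalues_mem_spectrum_real j))
    (Complex.normSq_nonneg _)

omit [DecidableEq ι] in
theorem re_trace_mul_nonneg (hA : A.PosSemidef) (hB : B.PosSemidef) :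
    0 ≤ (A * B).trace.re := by
  classical
  have h := sum_re_trace_cfc_mul_cfc_nonneg hA.1 hB.1 {()} (fun _ x => x) (fun _ y => y)
    fun x hx y hy => by
      simpa using mul_nonneg (spectrum_nonneg_of_nonneg hA.nonneg hx)
        (spectrum_nonneg_of_nonneg hB.nonneg hy)
  simpa only [Finset.sum_singleton, cfc_id' ℝ A hA.1.isSelfAdjoint,
    cfc_id' ℝ B hB.1.isSelfAdjoint] using h

theorem cfc_const_mul_pow (hA : A.IsHermitian) (c : ℝ) (k : ℕ) :
    cfc (fun x => c * x ^ k) A = c • A ^ k := by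
  rw [cfc_const_mul c (fun x => x ^ k) A (continuousOn_spectrum A _),
    cfc_pow_id A k hA.isSelfAdjoint]

theorem three_mul_re_trace_sq_mul_sq_le (hA : A.PosSemidef) (hB : B.PosSemidef) {c : ℝ}
    (hc : 0 < c) :
    3 * (A ^ 2 * B ^ 2).trace.re ≤
      c ^ 2 * (A ^ 4).trace.re + 2 * c⁻¹ * (A * B ^ 3).trace.re := by
  -- The scalar case is `0 ≤ u (c u - r)² (c u + 2 r)`, with equality at `c u = r`.
  have h := sum_re_trace_cfc_mul_cfc_nonneg hA.1 hB.1 (Finset.univ : Finset (Fin 3))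
    ![fun x => c ^ 2 * x ^ 4, fun x => 2 * c⁻¹ * x ^ 1, fun x => -3 * x ^ 2]
    ![fun y => 1 * y ^ 0, fun y => 1 * y ^ 3, fun y => 1 * y ^ 2] fun u hu r hr => by
      have hu0 : 0 ≤ u := spectrum_nonneg_of_nonneg hA.nonneg hu
      have hr0 : 0 ≤ r := spectrum_nonneg_of_nonneg hB.nonneg hr
      have hfactor : 0 ≤ c⁻¹ * u * (c * u - r) ^ 2 * (c * u + 2 * r) := by positivity
      convert hfactor using 1
      simp only [Fin.sum_univ_three, Matrix.cons_val]
      field_simp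
      ring
  simp only [Fin.sum_univ_three, Matrix.cons_val, cfc_const_mul_pow hA.1,
    cfc_const_mul_pow hB.1] at h
  simp only [one_smul, pow_zero, pow_one, mul_one, smul_mul_assoc, Matrix.trace_smul,
    Complex.smul_re, smul_eq_mul] at h
  linarith

theorem posSemidef_sqrt (A : Matrix ι ι ℂ) : (CFC.sqrt A).PosSemidef :=
  Matrix.nonneg_iff_posSemidef.mp (CFC.sqrt_nonneg A)

theorem exists_posSemidef_pow_four_eq (hA : A.PosSemidef) :
    ∃ R : Matrix ι ι ℂ, R.PosSemidef ∧ R ^ 4 = A := by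
  refine ⟨CFC.sqrt (CFC.sqrt A), posSemidef_sqrt _, ?_⟩
  rw [pow_mul _ 2 2, CFC.sq_sqrt _ (CFC.sqrt_nonneg A), CFC.sq_sqrt A hA.nonneg]

end FunctionalCalculus

section HilbertSchmidt

variable {ι κ : Type*} [Fintype ι] [Fintype κ]

/-- The squared Hilbert–Schmidt norm of a matrix. -/
def hsNormSq (X : Matrix κ ι ℂ) : ℝ := (Xᴴ * X).trace.re

theorem hsNormSq_nonneg (X : Matrix κ ι ℂ) : 0 ≤ hsNormSq X :=
  (Complex.le_def.mp (Matrix.posSemidef_conjTranspose_mul_self X).trace_nonneg).1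

theorem re_trace_mul_conjTranspose_self (X : Matrix κ ι ℂ) :
    (X * Xᴴ).trace.re = hsNormSq X := by
  rw [Matrix.trace_mul_comm, hsNormSq]

theorem hsNormSq_smul (c : ℂ) (X : Matrix κ ι ℂ) :
    hsNormSq (c • X) = Complex.normSq c * hsNormSq X := by
  rw [hsNormSq, Matrix.conjTranspose_smul, Matrix.smul_mul, Matrix.mul_smul, smul_smul,
    Matrix.trace_smul, Complex.star_def, ← Complex.normSq_eq_conj_mul_self, smul_eq_mul,
    Complex.re_ofReal_mul, hsNormSq]

theorem two_mul_re_trace_conjTranspose_mul_le (C D : Matrix κ ι ℂ) :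
    2 * (Cᴴ * D).trace.re ≤ hsNormSq C + hsNormSq D := by
  have hpos := hsNormSq_nonneg (C - D)
  have hconj : (Dᴴ * C).trace.re = (Cᴴ * D).trace.re := by
    rw [← Complex.conj_re, ← Complex.star_def, ← Matrix.trace_conjTranspose,
      Matrix.conjTranspose_mul, Matrix.conjTranspose_conjTranspose]
  simp only [hsNormSq, Matrix.conjTranspose_sub, Matrix.sub_mul, Matrix.mul_sub, Matrix.trace_sub,
    Complex.sub_re] at hpos ⊢
  linarith

end HilbertSchmidt

section Ensemble

variable {ι κ N E A' : Type*} [DecidableEq κ]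

/-- The family obtained from `q` by merging, for every `k`, the members in the fiber of `f` over
`k`. -/
def fiberSum [Fintype ι] [AddCommMonoid N] (f : ι → κ) (q : ι → N) (k : κ) : N :=
  ∑ a with f a = k, q a

theorem sum_fiberSum [Fintype ι] [Fintype κ] [AddCommMonoid N] (f : ι → κ) (q : ι → N) :
    ∑ k, fiberSum f q k = ∑ a, q a :=
  Finset.sum_fiberwise _ _ _

theorem posSemidef_fiberSum [Fintype ι] {q : ι → Matrix E E ℂ}
    (hq : ∀ a, (q a).PosSemidef) (f : ι → κ) (k : κ) : (fiberSum f q k).PosSemidef :=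
  Matrix.posSemidef_sum _ fun a _ => hq a

/-- The vector `∑ a, |a⟩ ⊗ T a`, with `T a` regarded as an element of `E ⊗ A'`, purifies the
classical-quantum operator `∑ a, |a⟩⟨a| ⊗ q a`. -/
def IsEnsemblePurification [DecidableEq ι] [Fintype A'] (T : ι → Matrix E A' ℂ)
    (q : ι → Matrix E E ℂ) : Prop :=
  ∀ a b, T a * (T b)ᴴ = if a = b then q a else 0

namespace IsEnsemblePurification

variable [DecidableEq ι] [Fintype A'] {T : ι → Matrix E A' ℂ} {q : ι → Matrix E E ℂ}

theorem fiberSum [Fintype ι] (hT : IsEnsemblePurification T q) (f : ι → κ) {w : ι → ℂ}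
    (hw : ∀ a, w a * star (w a) = 1) :
    IsEnsemblePurification (fiberSum f fun a => w a • T a) (fiberSum f q) := by
  intro k l
  have hsmul (a b : ι) : w a • T a * (w b • T b)ᴴ = if a = b then q a else 0 := by
    rw [Matrix.conjTranspose_smul, Matrix.smul_mul, Matrix.mul_smul, smul_smul, hT]
    rcases eq_or_ne a b with rfl | hab
    · rw [hw, one_smul]
    · rw [if_neg hab, smul_zero]
  simp only [PhaseEC.fiberSum, Matrix.conjTranspose_sum, Matrix.sum_mul, Matrix.mul_sum, hsmul,
    Finset.sum_ite_eq', Finset.mem_filter_univ]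
  split_ifs with hkl
  · exact Finset.sum_congr (by rw [hkl]) fun b hb =>
      if_pos ((Finset.mem_filter_univ b).mp hb)
  · exact Finset.sum_eq_zero fun b hb =>
      if_neg fun hbk => hkl (hbk.symm.trans ((Finset.mem_filter_univ b).mp hb))

theorem mul_left [Fintype E] (hT : IsEnsemblePurification T q) (C : ι → Matrix E E ℂ) :
    IsEnsemblePurification (fun a => C a * T a) fun a => C a * q a * (C a)ᴴ := by
  intro a b
  rw [Matrix.conjTranspose_mul, Matrix.mul_assoc, ← Matrix.mul_assoc (T a), hT]
  rcases eq_or_ne a b with rfl | hab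
  · simp only [if_true, Matrix.mul_assoc]
  · rw [if_neg hab, if_neg hab, Matrix.zero_mul, Matrix.mul_zero]

theorem sum_conjTranspose_mul_self_le_one [Fintype ι] [Fintype E] [DecidableEq A']
    (hT : IsEnsemblePurification T q) (hq : ∀ a, q a * T a = T a) :
    ∑ a, (T a)ᴴ * T a ≤ 1 := by
  suffices h : IsStarProjection (∑ a, (T a)ᴴ * T a) from h.le_one
  refine ⟨?_, ?_⟩
  · rw [IsIdempotentElem, Finset.sum_mul_sum]
    refine Finset.sum_congr rfl fun a _ => ?_
    have hab (b : ι) : (T a)ᴴ * T a * ((T b)ᴴ * T b) = if a = b then (T a)ᴴ * T a else 0 := by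
      rw [Matrix.mul_assoc, ← Matrix.mul_assoc (T a), hT]
      rcases eq_or_ne a b with rfl | hab
      · rw [if_pos rfl, if_pos rfl, hq]
      · rw [if_neg hab, if_neg hab, Matrix.zero_mul, Matrix.mul_zero]
    simp only [hab, Finset.sum_ite_eq, Finset.mem_univ, if_true]
  · simp only [IsSelfAdjoint, Matrix.star_eq_conjTranspose, Matrix.conjTranspose_sum,
      Matrix.conjTranspose_mul, Matrix.conjTranspose_conjTranspose]

end IsEnsemblePurification

end Ensemble

section Whiten

variable {κ E : Type*} [Fintype E] [DecidableEq E] {R q : Matrix E E ℂ}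

/-- The operator `R⁻¹ q R⁻¹`, with the Moore–Penrose inverse of `R`. -/
def whiten (R q : Matrix E E ℂ) : Matrix E E ℂ := pinv R * q * pinv R

theorem posSemidef_whiten (hq : q.PosSemidef) : (whiten R q).PosSemidef := by
  have h := hq.mul_mul_conjTranspose_same (pinv R)
  rwa [conjTranspose_pinv] at h

theorem whiten_sum (s : Finset κ) (q : κ → Matrix E E ℂ) :
    whiten R (∑ a ∈ s, q a) = ∑ a ∈ s, whiten R (q a) := by
  simp only [whiten, Matrix.mul_sum, Matrix.sum_mul]

theorem whiten_pow_add_two (hR : R.IsHermitian) (k : ℕ) :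
    whiten R (R ^ (k + 2)) = supportProj R * R ^ k * supportProj R := by
  rw [whiten, pow_succ, pow_succ', ← pinv_mul_self hR]
  nth_rw 2 [pinv_mul_self hR]
  simp only [supportProj, Matrix.mul_assoc]

theorem whiten_sq (hR : R.IsHermitian) : whiten R (R ^ 2) = supportProj R := by
  rw [whiten_pow_add_two hR 0, pow_zero, Matrix.mul_one,
    (isStarProjection_supportProj hR).isIdempotentElem]

theorem whiten_pow_four (hR : R.IsHermitian) : whiten R (R ^ 4) = R ^ 2 := by
  rw [whiten_pow_add_two hR 2, pow_two, ← Matrix.mul_assoc, supportProj_mul_self hR,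
    Matrix.mul_assoc, self_mul_supportProj hR]

theorem trace_whiten_mul_whiten (R q : Matrix E E ℂ) :
    (whiten R q * whiten R q).trace = (q * whiten R (whiten R q)).trace := by
  conv_lhs => enter [1, 1]; rw [whiten]
  conv_rhs => enter [1, 2]; rw [whiten]
  rw [Matrix.mul_assoc, Matrix.mul_assoc, Matrix.trace_mul_comm]
  simp only [Matrix.mul_assoc]

end Whiten

section SquareRoot

variable {κ E A' : Type*} [Fintype E] [DecidableEq E] {R : Matrix E E ℂ} {Q : κ → Matrix E E ℂ}

/-- The square-root (pretty good) decoder of the ensemble `Q` with vectors `Φ`. Here `R` stands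
for the fourth root of `∑ k, Q k`. -/
def squareRootDecoder (R : Matrix E E ℂ) (Q : κ → Matrix E E ℂ) (Φ : κ → Matrix E A' ℂ) (k : κ) :
    Matrix E A' ℂ :=
  pinv (CFC.sqrt (whiten R (Q k))) * pinv R * Φ k

/-- The sum of the overlaps of the square-root decoder with the vectors it decodes. -/
def squareRootOverlap [Fintype κ] (R : Matrix E E ℂ) (Q : κ → Matrix E E ℂ) : Matrix E E ℂ :=
  (∑ k, CFC.sqrt (whiten R (Q k))) * R

theorem pinv_sqrt_mul_self {D : Matrix E E ℂ} (hD : D.PosSemidef) :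
    pinv (CFC.sqrt D) * D = CFC.sqrt D := by
  nth_rw 2 [← CFC.sqrt_mul_sqrt_self D hD.nonneg]
  rw [← Matrix.mul_assoc, pinv_mul_self (posSemidef_sqrt D).1,
    supportProj_mul_self (posSemidef_sqrt D).1]

section

variable [Fintype A'] [DecidableEq κ] {Φ : κ → Matrix E A' ℂ}

theorem isEnsemblePurification_squareRootDecoder (hQ : ∀ k, (Q k).PosSemidef)
    (hΦ : IsEnsemblePurification Φ Q) :
    IsEnsemblePurification (squareRootDecoder R Q Φ)
      fun k => supportProj (CFC.sqrt (whiten R (Q k))) := by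
  set C : κ → Matrix E E ℂ := fun k => pinv (CFC.sqrt (whiten R (Q k))) * pinv R with hC
  have hCQC (k : κ) : supportProj (CFC.sqrt (whiten R (Q k))) = C k * Q k * (C k)ᴴ := by
    rw [supportProj]
    nth_rw 1 [← pinv_sqrt_mul_self (posSemidef_whiten (hQ k))]
    simp only [hC, whiten, Matrix.conjTranspose_mul, conjTranspose_pinv, Matrix.mul_assoc]
  rw [funext hCQC]
  exact hΦ.mul_left C

theorem sum_squareRootDecoder_le_one [Fintype κ] [DecidableEq A'] (hQ : ∀ k, (Q k).PosSemidef)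
    (hΦ : IsEnsemblePurification Φ Q) :
    ∑ k, (squareRootDecoder R Q Φ k)ᴴ * squareRootDecoder R Q Φ k ≤ 1 := by
  refine (isEnsemblePurification_squareRootDecoder hQ hΦ).sum_conjTranspose_mul_self_le_one
    fun k => ?_
  rw [squareRootDecoder, ← Matrix.mul_assoc, ← Matrix.mul_assoc,
    supportProj_mul_pinv (posSemidef_sqrt _).1]

theorem squareRootDecoder_mul_conjTranspose [Fintype κ] (hR : R.IsHermitian)
    (hQ : ∀ k, (Q k).PosSemidef) (hsum : ∑ k, Q k = R ^ 4) (hΦ : IsEnsemblePurification Φ Q)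
    (k l : κ) :
    squareRootDecoder R Q Φ k * (Φ l)ᴴ = if k = l then CFC.sqrt (whiten R (Q k)) * R else 0 := by
  rw [squareRootDecoder, Matrix.mul_assoc, hΦ]
  split_ifs with hkl
  swap
  · exact Matrix.mul_zero _
  have hle : Q k ≤ R ^ 4 := hsum ▸
    Finset.single_le_sum (fun k _ => (hQ k).nonneg) (Finset.mem_univ k)
  have hsupp : Q k * supportProj R = Q k := by
    have h := congrArg Matrix.conjTranspose (supportProj_mul_of_le_pow hR (hQ k) four_ne_zero hle)
    rwa [Matrix.conjTranspose_mul, (hQ k).1, ← Matrix.star_eq_conjTranspose,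
      (isStarProjection_supportProj hR).isSelfAdjoint] at h
  calc pinv (CFC.sqrt (whiten R (Q k))) * pinv R * Q k
      = pinv (CFC.sqrt (whiten R (Q k))) * whiten R (Q k) * R := by
        nth_rw 2 [← hsupp]
        rw [← pinv_mul_self hR]
        simp only [whiten, Matrix.mul_assoc]
    _ = CFC.sqrt (whiten R (Q k)) * R := by
        rw [pinv_sqrt_mul_self (posSemidef_whiten (hQ k))]

theorem sum_squareRootDecoder_mul_sum_conjTranspose [Fintype κ] (hR : R.IsHermitian)
    (hQ : ∀ k, (Q k).PosSemidef) (hsum : ∑ k, Q k = R ^ 4) (hΦ : IsEnsemblePurification Φ Q) :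
    (∑ k, squareRootDecoder R Q Φ k) * (∑ k, Φ k)ᴴ = squareRootOverlap R Q := by
  simp only [Matrix.conjTranspose_sum, Matrix.sum_mul, Matrix.mul_sum,
    squareRootDecoder_mul_conjTranspose hR hQ hsum hΦ, Finset.sum_ite_eq', Finset.mem_univ,
    if_true, squareRootOverlap]

end

theorem two_mul_re_trace_le_squareRootOverlap [Fintype κ] (hR : R.PosSemidef)
    (hQ : ∀ k, (Q k).PosSemidef) (hsum : ∑ k, Q k = R ^ 4) {c : ℝ} (hc : 0 < c) :
    2 * (R ^ 4).trace.re ≤ c ^ 2 * ∑ k, (whiten R (Q k) ^ 2).trace.re +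
      (c ^ 2)⁻¹ * hsNormSq (squareRootOverlap R Q) := by
  set U : κ → Matrix E E ℂ := fun k => CFC.sqrt (whiten R (Q k))
  have hU2 (k : κ) : U k ^ 2 = whiten R (Q k) := CFC.sq_sqrt _ (posSemidef_whiten (hQ k)).nonneg
  have hU2R2 : ∑ k, (U k ^ 2 * R ^ 2).trace.re = (R ^ 4).trace.re := by
    simp only [← Complex.re_sum, ← Matrix.trace_sum, ← Matrix.sum_mul, hU2, ← whiten_sum, hsum,
      whiten_pow_four hR.1, ← pow_add]
  have hUR3 : ∑ k, (U k * R ^ 3).trace.re = (R ^ 2 * squareRootOverlap R Q).trace.re := by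
    rw [Matrix.trace_mul_comm, squareRootOverlap, Matrix.mul_assoc, ← pow_succ',
      Matrix.sum_mul, Matrix.trace_sum, Complex.re_sum]
  have hklein : 3 * (R ^ 4).trace.re ≤ c ^ 2 * ∑ k, (whiten R (Q k) ^ 2).trace.re +
      2 * c⁻¹ * (R ^ 2 * squareRootOverlap R Q).trace.re := by
    rw [← hU2R2, ← hUR3]
    simp only [← hU2, ← pow_mul, Finset.mul_sum, ← Finset.sum_add_distrib]
    exact Finset.sum_le_sum fun k _ => three_mul_re_trace_sq_mul_sq_le (posSemidef_sqrt _) hR hc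
  have hyoung := two_mul_re_trace_conjTranspose_mul_le (R ^ 2)
    (((c⁻¹ : ℝ) : ℂ) • squareRootOverlap R Q)
  rw [hsNormSq_smul, Complex.normSq_ofReal, ← pow_two, inv_pow, hsNormSq, hR.1.pow 2, ← pow_add,
    Matrix.mul_smul, Matrix.trace_smul, smul_eq_mul, Complex.re_ofReal_mul] at hyoung
  linarith

end SquareRoot

section Phases

variable {d : ℕ}

theorem sgn_zero : sgn 0 = 1 := by simp [sgn]

theorem sgn_of_ne_zero {b : ZMod 2} (hb : b ≠ 0) : sgn b = -1 := by
  obtain rfl : b = 1 := by revert b; decide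
  simp [sgn, ZMod.val_one]

theorem sgn_add (a b : ZMod 2) : sgn (a + b) = sgn a * sgn b := by
  rw [sgn, ZMod.val_add, ← neg_one_pow_eq_pow_mod_two, pow_add, sgn, sgn]

theorem sgn_mul_self (a : ZMod 2) : sgn a * sgn a = 1 := by
  rw [← sgn_add, CharTwo.add_self_eq_zero, sgn_zero]

theorem star_sgn (a : ZMod 2) : star (sgn a) = sgn a := by
  simp [sgn]

theorem bits_add_eq_zero {a b : Bits d} : a + b = 0 ↔ a = b := by
  rw [add_eq_zero_iff_eq_neg, show -b = b from funext fun i => CharTwo.neg_eq (b i)]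

theorem sum_sgn_dotProduct (z : Bits d) :
    ∑ x : Bits d, sgn (x ⬝ᵥ z) = if z = 0 then (2 : ℂ) ^ d else 0 := by
  split_ifs with hz
  · subst hz
    simp [sgn_zero, ZMod.card]
  · obtain ⟨i, hi⟩ := Function.ne_iff.mp hz
    have hflip : ∑ x : Bits d, sgn (x ⬝ᵥ z) = -∑ x : Bits d, sgn (x ⬝ᵥ z) := by
      conv_lhs => rw [← Equiv.sum_comp (Equiv.addRight (Pi.single i 1 : Bits d))]
      rw [← Finset.sum_neg_distrib]
      refine Finset.sum_congr rfl fun x _ => ?_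
      simp [add_dotProduct, sgn_add, sgn_of_ne_zero hi]
    exact self_eq_neg.mp hflip

/-- The normalization constant `2^(-d/2)` of the phase basis. -/
def phaseNorm (d : ℕ) : ℂ := (((Real.sqrt (2 ^ d))⁻¹ : ℝ) : ℂ)

theorem phaseKet_apply (x z : Bits d) : phaseKet x z = phaseNorm d * sgn (x ⬝ᵥ z) := rfl

theorem star_phaseNorm (d : ℕ) : star (phaseNorm d) = phaseNorm d :=
  Complex.conj_ofReal _

theorem normSq_phaseNorm (d : ℕ) : Complex.normSq (phaseNorm d) = ((2 : ℝ) ^ d)⁻¹ := by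
  rw [phaseNorm, Complex.normSq_ofReal, ← mul_inv, Real.mul_self_sqrt (by positivity)]

theorem phaseNorm_mul_self (d : ℕ) : phaseNorm d * phaseNorm d = ((2 : ℂ) ^ d)⁻¹ := by
  nth_rw 1 [← star_phaseNorm]
  rw [Complex.star_def, ← Complex.normSq_eq_conj_mul_self, normSq_phaseNorm]
  push_cast
  rfl

theorem star_phaseKet_apply (x z : Bits d) : star (phaseKet x z) = phaseKet x z := by
  rw [phaseKet_apply, star_mul', star_phaseNorm, star_sgn]

theorem sum_fourier_conjTranspose_mul_self {m : ℕ} {E A' : Type*} [Fintype E]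
    (W : Bits m → Matrix E A' ℂ) :
    ∑ y, (phaseNorm m • ∑ k, sgn (y ⬝ᵥ k) • W k)ᴴ * (phaseNorm m • ∑ k, sgn (y ⬝ᵥ k) • W k) =
      ∑ k, (W k)ᴴ * W k := by
  have hexpand (y : Bits m) :
      (phaseNorm m • ∑ k, sgn (y ⬝ᵥ k) • W k)ᴴ * (phaseNorm m • ∑ k, sgn (y ⬝ᵥ k) • W k) =
        ∑ k, ∑ l, (((2 : ℂ) ^ m)⁻¹ * sgn (y ⬝ᵥ (k + l))) • ((W k)ᴴ * W l) := by
    simp only [Matrix.conjTranspose_smul, Matrix.conjTranspose_sum, Matrix.smul_mul,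
      Matrix.mul_smul, smul_smul, Matrix.sum_mul, Matrix.mul_sum, Finset.smul_sum]
    rw [Finset.sum_comm]
    refine Finset.sum_congr rfl fun k _ => Finset.sum_congr rfl fun l _ => ?_
    rw [dotProduct_add, sgn_add, ← phaseNorm_mul_self, star_mul', star_sgn, star_phaseNorm]
    congr 1
    ring
  simp only [hexpand]
  rw [Finset.sum_comm]
  refine Finset.sum_congr rfl fun k _ => ?_
  rw [Finset.sum_comm]
  simp only [← Finset.sum_smul, ← Finset.mul_sum, sum_sgn_dotProduct, bits_add_eq_zero, mul_ite,
    mul_zero, ite_smul, zero_smul, Finset.sum_ite_eq, Finset.mem_univ, if_true]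
  rw [inv_mul_cancel₀ (by positivity), one_smul]

theorem phaseKet_zero_vecMul_pauliZ (e : Bits d) : phaseKet 0 ᵥ* pauliZ e = phaseKet e := by
  ext j
  simp [pauliZ, Matrix.vecMul_diagonal, phaseKet_apply, sgn_zero]

theorem pauliZ_conjTranspose_mul_self (e : Bits d) : (pauliZ e)ᴴ * pauliZ e = 1 := by
  rw [pauliZ, Matrix.diagonal_conjTranspose, Matrix.diagonal_mul_diagonal]
  simp only [Pi.star_apply, star_sgn, sgn_mul_self, Matrix.diagonal_one]

theorem phaseKet_vecMul_pauliX (x y : Bits d) :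
    phaseKet x ᵥ* pauliX y = sgn (y ⬝ᵥ x) • phaseKet x := by
  ext j
  simp only [Matrix.vecMul, dotProduct, pauliX, Matrix.of_apply, mul_ite, mul_one, mul_zero,
    Finset.sum_ite_eq', Finset.mem_univ, if_true, Pi.smul_apply, smul_eq_mul]
  rw [phaseKet_apply, phaseKet_apply, dotProduct_add, sgn_add, ← dotProduct, dotProduct_comm y x]
  ring

theorem phaseKet_vecMul_pauliX_eigenprojection (x y : Bits d) (b : ZMod 2) :
    phaseKet x ᵥ* ((2⁻¹ : ℂ) • (1 + sgn b • pauliX y)) =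
      (if y ⬝ᵥ x = b then 1 else 0 : ℂ) • phaseKet x := by
  rw [Matrix.vecMul_smul, Matrix.vecMul_add, Matrix.vecMul_one, Matrix.vecMul_smul,
    phaseKet_vecMul_pauliX, smul_smul, ← sgn_add]
  split_ifs with hb
  · rw [hb, CharTwo.add_self_eq_zero, sgn_zero, one_smul, ← two_smul ℂ (phaseKet x), smul_smul]
    norm_num
  · have hne : b + y ⬝ᵥ x ≠ 0 := fun h => hb (by
      rwa [add_eq_zero_iff_neg_eq, CharTwo.neg_eq, eq_comm] at h)
    rw [sgn_of_ne_zero hne, neg_one_smul, add_neg_cancel, smul_zero, zero_smul]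

end Phases

section SyndromeMeasurement

variable {n r : ℕ} (h : Matrix (Fin r) (Fin n) (ZMod 2))

theorem phaseKet_vecMul_syndromeProj (s : Bits r) (x : Bits n) :
    phaseKet x ᵥ* syndromeProj h s = (if h *ᵥ x = s then 1 else 0 : ℂ) • phaseKet x := by
  have hprod (l : List (Fin r)) :
      phaseKet x ᵥ* (l.map fun j => (2⁻¹ : ℂ) • (1 + sgn (s j) • pauliX (h j))).prod =
        (if ∀ j ∈ l, (h *ᵥ x) j = s j then 1 else 0 : ℂ) • phaseKet x := by
    induction l with
    | nil => simp
    | cons j l ih =>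
      rw [List.map_cons, List.prod_cons, ← Matrix.vecMul_vecMul,
        phaseKet_vecMul_pauliX_eigenprojection, Matrix.smul_vecMul, ih, smul_smul, ite_mul, one_mul,
        zero_mul, ← ite_and]
      simp only [List.forall_mem_cons]
      rfl
  rw [syndromeProj, List.ofFn_eq_map, hprod]
  simp only [List.mem_finRange, true_imp_iff, funext_iff]

/-- The change from the bit basis to the phase basis. -/
def hadamard (d : ℕ) : Matrix (Bits d) (Bits d) ℂ := Matrix.of fun x z => phaseKet x z

theorem hadamard_conjTranspose_mul_self (d : ℕ) : (hadamard d)ᴴ * hadamard d = 1 := by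
  ext i j
  have hentry : ((hadamard d)ᴴ * hadamard d) i j =
      ((2 : ℂ) ^ d)⁻¹ * ∑ x : Bits d, sgn (x ⬝ᵥ (i + j)) := by
    rw [Matrix.mul_apply, Finset.mul_sum]
    refine Finset.sum_congr rfl fun x _ => ?_
    rw [Matrix.conjTranspose_apply, hadamard, Matrix.of_apply, Matrix.of_apply,
      star_phaseKet_apply, phaseKet_apply, phaseKet_apply, dotProduct_add, sgn_add,
      ← phaseNorm_mul_self]
    ring
  rw [hentry, sum_sgn_dotProduct, Matrix.one_apply]
  simp only [bits_add_eq_zero]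
  split_ifs <;> simp

theorem hadamard_mul_syndromeProj (s : Bits r) : hadamard n * syndromeProj h s =
    Matrix.diagonal (fun x => if h *ᵥ x = s then 1 else 0) * hadamard n := by
  ext x z
  rw [Matrix.diagonal_mul]
  exact congrFun (phaseKet_vecMul_syndromeProj h s x) z

theorem syndromeProj_conjTranspose_mul_self (s : Bits r) :
    (syndromeProj h s)ᴴ * syndromeProj h s =
      (hadamard n)ᴴ * Matrix.diagonal (fun x => if h *ᵥ x = s then (1 : ℂ) else 0) *
        hadamard n := by
  calc (syndromeProj h s)ᴴ * syndromeProj h s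
      = (hadamard n * syndromeProj h s)ᴴ * (hadamard n * syndromeProj h s) := by
        rw [Matrix.conjTranspose_mul, Matrix.mul_assoc, ← Matrix.mul_assoc (hadamard n)ᴴ,
          hadamard_conjTranspose_mul_self, Matrix.one_mul]
    _ = _ := by
        rw [hadamard_mul_syndromeProj, Matrix.conjTranspose_mul, Matrix.diagonal_conjTranspose,
          Matrix.mul_assoc, ← Matrix.mul_assoc (Matrix.diagonal _), Matrix.diagonal_mul_diagonal,
          Matrix.mul_assoc]
        congr 4 with x
        simp

theorem sum_syndromeProj_conjTranspose_mul_self :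
    ∑ s, (syndromeProj h s)ᴴ * syndromeProj h s = 1 := by
  have hdiag : ∑ s, Matrix.diagonal (fun x => if h *ᵥ x = s then (1 : ℂ) else 0) = 1 := by
    rw [← Matrix.diagonal_one]
    ext i j
    simp [Matrix.sum_apply, Matrix.diagonal_apply]
  simp only [syndromeProj_conjTranspose_mul_self]
  rw [← Finset.sum_mul, ← Finset.mul_sum, hdiag, Matrix.mul_one, hadamard_conjTranspose_mul_self]

end SyndromeMeasurement

section PartialTrace

variable {ι κ τ E A' : Type*} [Fintype A']

theorem kronecker_sum {α β γ δ : Type*} (B : Matrix α β ℂ) (C : τ → Matrix γ δ ℂ) (s : Finset τ) :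
    B ⊗ₖ ∑ i ∈ s, C i = ∑ i ∈ s, B ⊗ₖ C i :=
  map_sum (Matrix.kroneckerBilinear (R := ℂ) B) C s

theorem sum_kronecker {α β γ δ : Type*} (B : τ → Matrix α β ℂ) (C : Matrix γ δ ℂ) (s : Finset τ) :
    (∑ i ∈ s, B i) ⊗ₖ C = ∑ i ∈ s, B i ⊗ₖ C :=
  map_sum ((Matrix.kroneckerBilinear (R := ℂ)).flip C) B s

theorem trace_ptrace [Fintype ι] [Fintype κ] (ρ : Matrix (ι × κ) (ι × κ) ℂ) :
    (ptrace ρ).trace = ρ.trace := by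
  simp [Matrix.trace, ptrace, Fintype.sum_prod_type]

theorem ptrace_sum [Fintype κ] (s : Finset τ) (ρ : τ → Matrix (ι × κ) (ι × κ) ℂ) :
    ptrace (∑ i ∈ s, ρ i) = ∑ i ∈ s, ptrace (ρ i) := by
  ext i j
  simp only [ptrace, Matrix.of_apply, Matrix.sum_apply]
  exact Finset.sum_comm

theorem mul_ketbra_mul_conjTranspose [Fintype ι] (K : Matrix κ ι ℂ) (ψ : ι → ℂ) :
    K * ketbra ψ * Kᴴ = ketbra (K *ᵥ ψ) := by
  rw [ketbra, ketbra, Matrix.mul_vecMulVec, Matrix.vecMulVec_mul, Matrix.star_mulVec]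

/-- The component `(⟨a| ⊗ 1) Ψ` of `Ψ` in `E ⊗ A'`, regarded as a matrix. -/
def bitComp (Ψ : (ι × E) × A' → ℂ) (a : ι) : Matrix E A' ℂ :=
  Matrix.of fun e α => Ψ ((a, e), α)

theorem ptrace_ptrace_ketbra [Fintype E] (χ : (ι × E) × A' → ℂ) (i j : ι) :
    ptrace (ptrace (ketbra χ)) i j = (bitComp χ i * (bitComp χ j)ᴴ).trace := by
  simp [ptrace, ketbra, Matrix.vecMulVec_apply, Matrix.trace, Matrix.mul_apply, bitComp]

theorem dotProduct_ptrace_ptrace_ketbra [Fintype ι] [Fintype E] (χ : (ι × E) × A' → ℂ) (v : ι → ℂ) :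
    star v ⬝ᵥ (ptrace (ptrace (ketbra χ)) *ᵥ v) =
      ((∑ i, star (v i) • bitComp χ i) * (∑ i, star (v i) • bitComp χ i)ᴴ).trace := by
  simp only [dotProduct, Matrix.mulVec, ptrace_ptrace_ketbra, Matrix.conjTranspose_sum,
    Matrix.conjTranspose_smul, star_star, Matrix.sum_mul, Matrix.mul_sum, Matrix.trace_sum,
    Finset.mul_sum, Matrix.smul_mul, Matrix.mul_smul, Matrix.trace_smul, smul_eq_mul,
    Pi.star_apply]
  rw [Finset.sum_comm]
  refine Finset.sum_congr rfl fun i _ => Finset.sum_congr rfl fun j _ => ?_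
  ring

theorem bitComp_kronecker_mulVec [Fintype ι] [Fintype E] [DecidableEq E] (B : Matrix κ ι ℂ)
    (C : Matrix A' A' ℂ) (Ψ : (ι × E) × A' → ℂ) (i : κ) :
    bitComp (((B ⊗ₖ (1 : Matrix E E ℂ)) ⊗ₖ C) *ᵥ Ψ) i = ∑ b, B i b • (bitComp Ψ b * Cᵀ) := by
  ext e α
  simp only [bitComp, Matrix.of_apply, Matrix.mulVec, dotProduct, Fintype.sum_prod_type,
    Matrix.kronecker_apply, Matrix.one_apply, Matrix.sum_apply, Matrix.smul_apply,
    Matrix.mul_apply, Matrix.transpose_apply, smul_eq_mul, Finset.mul_sum, mul_ite, mul_one,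
    mul_zero, ite_mul, zero_mul]
  refine Finset.sum_congr rfl fun b _ => ?_
  rw [Finset.sum_comm]
  simp only [Finset.sum_ite_eq, Finset.mem_univ, if_true, mul_assoc, mul_comm]

theorem isEnsemblePurification_bitComp [Fintype ι] [DecidableEq ι] {Ψ : (ι × E) × A' → ℂ}
    {ρ : Matrix (ι × E) (ι × E) ℂ} (hΨ : IsPurification Ψ ρ) {q : ι → Matrix E E ℂ}
    (hq : ρ = ∑ a, Matrix.single a a (1 : ℂ) ⊗ₖ q a) : IsEnsemblePurification (bitComp Ψ) q := by
  intro a b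
  ext e f
  have hentry : (bitComp Ψ a * (bitComp Ψ b)ᴴ) e f = ρ (a, e) (b, f) := by
    rw [← hΨ]
    simp [bitComp, Matrix.mul_apply, ptrace, ketbra, Matrix.vecMulVec_apply]
  rw [hentry, hq, Matrix.sum_apply]
  simp only [Matrix.kronecker_apply, Matrix.single_apply, ite_and, ite_mul, one_mul, zero_mul,
    Finset.sum_ite_eq', Finset.mem_univ, if_true]
  split_ifs <;> rfl

end PartialTrace

section Correction

variable {n r : ℕ} {E A' : Type*} [Fintype E] [DecidableEq E] [Fintype A']
  (h : Matrix (Fin r) (Fin n) (ZMod 2))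

/-- The component of `∑ a, |a⟩ ⊗ T a` at the phase basis vector of `x`. -/
def phaseComp (T : Bits n → Matrix E A' ℂ) (x : Bits n) : Matrix E A' ℂ :=
  ∑ a, phaseKet x a • T a

/-- The Kraus operator of the phase error correction for the outcomes `s` and `e`, with ancilla
operator `C`. -/
def pecKraus (E : Type*) [DecidableEq E] (h : Matrix (Fin r) (Fin n) (ZMod 2)) (s : Bits r)
    (e : Bits n) (C : Matrix A' A' ℂ) :
    Matrix ((Bits n × E) × A') ((Bits n × E) × A') ℂ :=
  ((pauliZ e * syndromeProj h s) ⊗ₖ (1 : Matrix E E ℂ)) ⊗ₖ C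

theorem pec_eq_sum_pecKraus (M : Bits r → Bits n → Matrix A' A' ℂ)
    (ρ : Matrix ((Bits n × E) × A') ((Bits n × E) × A') ℂ) :
    pec h M ρ = ∑ s, ∑ e, pecKraus E h s e (M s e) * ρ * (pecKraus E h s e (M s e))ᴴ := rfl

theorem pecKraus_conjTranspose_mul_self (s : Bits r) (e : Bits n) (C : Matrix A' A' ℂ) :
    (pecKraus E h s e C)ᴴ * pecKraus E h s e C =
      (((syndromeProj h s)ᴴ * syndromeProj h s) ⊗ₖ (1 : Matrix E E ℂ)) ⊗ₖ (Cᴴ * C) := by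
  rw [pecKraus, Matrix.conjTranspose_kronecker, Matrix.conjTranspose_kronecker,
    ← Matrix.mul_kronecker_mul, ← Matrix.mul_kronecker_mul, Matrix.conjTranspose_mul,
    Matrix.mul_assoc, ← Matrix.mul_assoc (pauliZ e)ᴴ, pauliZ_conjTranspose_mul_self,
    Matrix.one_mul, Matrix.conjTranspose_one, Matrix.one_mul]

theorem sum_phaseKet_smul_bitComp_pecKraus (s : Bits r) (e : Bits n) (C : Matrix A' A' ℂ)
    (Ψ : (Bits n × E) × A' → ℂ) :
    ∑ i, star (phaseKet 0 i) • bitComp (pecKraus E h s e C *ᵥ Ψ) i =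
      (if h *ᵥ e = s then 1 else 0 : ℂ) • (phaseComp (bitComp Ψ) e * Cᵀ) := by
  have hentry (b : Bits n) : ∑ i, phaseKet 0 i * (pauliZ e * syndromeProj h s) i b =
      (if h *ᵥ e = s then 1 else 0 : ℂ) * phaseKet e b := by
    have hvec : phaseKet 0 ᵥ* (pauliZ e * syndromeProj h s) =
        (if h *ᵥ e = s then 1 else 0 : ℂ) • phaseKet e := by
      rw [← Matrix.vecMul_vecMul, phaseKet_zero_vecMul_pauliZ, phaseKet_vecMul_syndromeProj]
    exact congrFun hvec b
  simp only [pecKraus, bitComp_kronecker_mulVec, Finset.smul_sum, smul_smul, star_phaseKet_apply]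
  rw [Finset.sum_comm]
  simp only [← Finset.sum_smul, hentry, phaseComp, Matrix.sum_mul, Finset.smul_sum, smul_smul,
    Matrix.smul_mul]

variable [DecidableEq A'] (M : Bits r → Bits n → Matrix A' A' ℂ) (hM : ∀ s, IsMeasurement (M s))
include hM

theorem sum_pecKraus_conjTranspose_mul_self :
    ∑ s, ∑ e, (pecKraus E h s e (M s e))ᴴ * pecKraus E h s e (M s e) = 1 := by
  have hM' (s : Bits r) : ∑ e, (M s e)ᴴ * M s e = 1 := hM s
  simp only [pecKraus_conjTranspose_mul_self, ← kronecker_sum, hM', ← sum_kronecker,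
    sum_syndromeProj_conjTranspose_mul_self, Matrix.one_kronecker_one]

theorem trace_pec (ρ : Matrix ((Bits n × E) × A') ((Bits n × E) × A') ℂ) :
    (pec h M ρ).trace = ρ.trace := by
  simp only [pec_eq_sum_pecKraus, Matrix.trace_sum, Matrix.trace_mul_cycle _ ρ]
  simp only [← Matrix.trace_sum, ← Finset.sum_mul]
  rw [sum_pecKraus_conjTranspose_mul_self h M hM, Matrix.one_mul]

theorem phaseErrorProb_pec {Ψ : (Bits n × E) × A' → ℂ} {ρ : Matrix (Bits n × E) (Bits n × E) ℂ}
    (hΨ : IsPurification Ψ ρ) :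
    phaseErrorProb (ptrace (ptrace (pec h M (ketbra Ψ)))) =
      ρ.trace.re - ∑ e, hsNormSq (phaseComp (bitComp Ψ) e * (M (h *ᵥ e) e)ᵀ) := by
  rw [phaseErrorProb, trace_ptrace, trace_ptrace, trace_pec h M hM, ← trace_ptrace, hΨ,
    Complex.sub_re]
  congr 1
  simp only [pec_eq_sum_pecKraus, mul_ketbra_mul_conjTranspose, ptrace_sum, Matrix.sum_mulVec,
    dotProduct_sum, dotProduct_ptrace_ptrace_ketbra, sum_phaseKet_smul_bitComp_pecKraus,
    Complex.re_sum]
  rw [Finset.sum_comm]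
  refine Finset.sum_congr rfl fun e _ => ?_
  rw [Finset.sum_eq_single (h *ᵥ e) (fun s _ hs => by simp [hs.symm]) (by simp)]
  rw [if_pos rfl, one_smul, re_trace_mul_conjTranspose_self]

end Correction

section Code

variable {n m : ℕ} {g : Bits n →ₗ[ZMod 2] Bits m}

/-- The transpose of a linear map of bit strings, with respect to the dot product. -/
def dualMap (g : Bits n →ₗ[ZMod 2] Bits m) (y : Bits m) : Bits n :=
  fun i => y ⬝ᵥ g (Pi.single i 1)

theorem dualMap_dotProduct (g : Bits n →ₗ[ZMod 2] Bits m) (y : Bits m) (a : Bits n) :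
    dualMap g y ⬝ᵥ a = y ⬝ᵥ g a := by
  conv_rhs => rw [pi_eq_sum_univ' a]
  simp only [map_sum, dotProduct_sum, map_smul, dotProduct_smul]
  exact Finset.sum_congr rfl fun i _ => mul_comm _ _

theorem dualMap_injective (hg : Function.Surjective g) : Function.Injective (dualMap g) := by
  intro y y' hy
  refine dotProduct_eq _ _ fun k => ?_
  obtain ⟨a, rfl⟩ := hg k
  rw [← dualMap_dotProduct, ← dualMap_dotProduct, hy]

theorem dualMap_mem_code (g : Bits n →ₗ[ZMod 2] Bits m) (y : Bits m) : dualMap g y ∈ code g :=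
  fun a ha => by rw [dualMap_dotProduct, ha, dotProduct_zero]

theorem exists_dualMap_eq (hg : Function.Surjective g) {x : Bits n} (hx : x ∈ code g) :
    ∃ y, dualMap g y = x := by
  obtain ⟨σ, hσ⟩ := LinearMap.exists_rightInverse_of_surjective g (LinearMap.range_eq_top.mpr hg)
  refine ⟨dualMap σ x, dotProduct_eq _ _ fun a => ?_⟩
  have hker : g (σ (g a) - a) = 0 := by
    rw [map_sub, sub_eq_zero]
    exact LinearMap.congr_fun hσ (g a)
  rw [dualMap_dotProduct, dualMap_dotProduct, ← sub_eq_zero, ← dotProduct_sub]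
  exact hx _ hker

theorem sum_filter_syndrome_eq {r : ℕ} {N : Type*} [AddCommMonoid N]
    (hg : Function.Surjective g) {h : Matrix (Fin r) (Fin n) (ZMod 2)}
    (hh : IsCheckMatrix h (code g)) (x : Bits n) (F : Bits n → N) :
    ∑ e with h *ᵥ e = h *ᵥ x, F e = ∑ y, F (x + dualMap g y) := by
  symm
  refine Finset.sum_bij (fun y _ => x + dualMap g y) ?_ ?_ ?_ fun _ _ => rfl
  · intro y _
    simp [Matrix.mulVec_add, (hh _).mp (dualMap_mem_code g y)]
  · intro y _ y' _ hy
    exact dualMap_injective hg (add_left_cancel hy)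
  · intro e he
    have hcode : e - x ∈ code g := (hh _).mpr (by
      rw [Matrix.mulVec_sub, (Finset.mem_filter.mp he).2, sub_self])
    obtain ⟨y, hy⟩ := exists_dualMap_eq hg hcode
    exact ⟨y, Finset.mem_univ _, by rw [hy, add_sub_cancel]⟩

end Code

section PhaseDecoder

variable {n m r : ℕ} {E A' : Type*} [Fintype E] [DecidableEq E] {R : Matrix E E ℂ}
  {g : Bits n →ₗ[ZMod 2] Bits m} {h : Matrix (Fin r) (Fin n) (ZMod 2)}
  {q : Bits n → Matrix E E ℂ} {T : Bits n → Matrix E A' ℂ}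

omit [Fintype E] [DecidableEq E] in
theorem fiberSum_sgn_add_dualMap (g : Bits n →ₗ[ZMod 2] Bits m) (T : Bits n → Matrix E A' ℂ)
    (x : Bits n) (y k : Bits m) :
    fiberSum g (fun a => sgn ((x + dualMap g y) ⬝ᵥ a) • T a) k =
      sgn (y ⬝ᵥ k) • fiberSum g (fun a => sgn (x ⬝ᵥ a) • T a) k := by
  rw [fiberSum, fiberSum, Finset.smul_sum]
  refine Finset.sum_congr rfl fun a ha => ?_
  rw [add_dotProduct, dualMap_dotProduct, (Finset.mem_filter_univ a).mp ha, sgn_add, smul_smul,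
    mul_comm]

omit [Fintype E] [DecidableEq E] in
theorem phaseComp_eq_smul_sum_fiberSum (g : Bits n →ₗ[ZMod 2] Bits m)
    (T : Bits n → Matrix E A' ℂ) (e : Bits n) :
    phaseComp T e = phaseNorm n • ∑ k, fiberSum g (fun a => sgn (e ⬝ᵥ a) • T a) k := by
  simp only [sum_fiberSum, phaseComp, phaseKet_apply, Finset.smul_sum, smul_smul]

/-- The amplitude with which the ancilla guesses the phase `e`: the square-root decoder of the
hash value, read in the phase basis. `R` stands for the fourth root of `∑ a, q a`. -/
def phaseDecoder (R : Matrix E E ℂ) (g : Bits n →ₗ[ZMod 2] Bits m) (q : Bits n → Matrix E E ℂ)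
    (T : Bits n → Matrix E A' ℂ) (e : Bits n) : Matrix E A' ℂ :=
  phaseNorm m •
    ∑ k, squareRootDecoder R (fiberSum g q) (fiberSum g fun a => sgn (e ⬝ᵥ a) • T a) k

theorem phaseDecoder_add_dualMap (x : Bits n) (y : Bits m) :
    phaseDecoder R g q T (x + dualMap g y) = phaseNorm m • ∑ k, sgn (y ⬝ᵥ k) •
      squareRootDecoder R (fiberSum g q) (fiberSum g fun a => sgn (x ⬝ᵥ a) • T a) k := by
  simp only [phaseDecoder, squareRootDecoder, fiberSum_sgn_add_dualMap, Matrix.mul_smul]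

variable [Fintype A'] (hq : ∀ a, (q a).PosSemidef) (hT : IsEnsemblePurification T q)
include hq hT

theorem sum_filter_phaseDecoder_le_one [DecidableEq A'] (hg : Function.Surjective g)
    (hh : IsCheckMatrix h (code g)) (s : Bits r) :
    ∑ e with h *ᵥ e = s, (phaseDecoder R g q T e)ᴴ * phaseDecoder R g q T e ≤ 1 := by
  by_cases hs : ∃ x, h *ᵥ x = s
  · obtain ⟨x, rfl⟩ := hs
    rw [sum_filter_syndrome_eq hg hh]
    simp only [phaseDecoder_add_dualMap, sum_fourier_conjTranspose_mul_self]
    exact sum_squareRootDecoder_le_one (posSemidef_fiberSum hq g)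
      (hT.fiberSum g fun a => by rw [star_sgn, sgn_mul_self])
  · rw [Finset.sum_eq_zero fun e he => absurd ⟨e, (Finset.mem_filter_univ e).mp he⟩ hs]
    exact Matrix.PosSemidef.one.nonneg

variable (hsum : ∑ a, q a = R ^ 4)
include hsum

theorem phaseDecoder_mul_phaseComp_conjTranspose (hR : R.IsHermitian) (e : Bits n) :
    phaseDecoder R g q T e * (phaseComp T e)ᴴ =
      (phaseNorm m * phaseNorm n) • squareRootOverlap R (fiberSum g q) := by
  rw [phaseDecoder, phaseComp_eq_smul_sum_fiberSum g, Matrix.conjTranspose_smul, star_phaseNorm,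
    Matrix.smul_mul, Matrix.mul_smul, smul_smul,
    sum_squareRootDecoder_mul_sum_conjTranspose hR (posSemidef_fiberSum hq g)
      (by rw [sum_fiberSum, hsum]) (hT.fiberSum g fun a => by rw [star_sgn, sgn_mul_self])]

theorem sum_hsNormSq_phaseDecoder_mul_phaseComp (hR : R.IsHermitian) :
    ∑ e, hsNormSq (phaseDecoder R g q T e * (phaseComp T e)ᴴ) =
      ((2 : ℝ) ^ m)⁻¹ * hsNormSq (squareRootOverlap R (fiberSum g q)) := by
  simp only [phaseDecoder_mul_phaseComp_conjTranspose hq hT hsum hR, hsNormSq_smul,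
    Complex.normSq_mul, normSq_phaseNorm, Finset.sum_const, Finset.card_univ, Fintype.card_pi,
    ZMod.card, Finset.prod_const, Fintype.card_fin, nsmul_eq_mul, Nat.cast_pow, Nat.cast_ofNat]
  field_simp

theorem two_mul_re_trace_le_phaseDecoder (hR : R.PosSemidef) :
    2 * (R ^ 4).trace.re ≤ 2 ^ m * ∑ k, (whiten R (fiberSum g q k) ^ 2).trace.re +
      ∑ e, hsNormSq (phaseDecoder R g q T e * (phaseComp T e)ᴴ) := by
  rw [sum_hsNormSq_phaseDecoder_mul_phaseComp hq hT hsum hR.1]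
  have hbound := two_mul_re_trace_le_squareRootOverlap hR (posSemidef_fiberSum hq g)
    (by rw [sum_fiberSum, hsum]) (c := √(2 ^ m)) (by positivity)
  rwa [Real.sq_sqrt (by positivity)] at hbound

end PhaseDecoder

section Measurement

variable {n r : ℕ} {E A' : Type*}

theorem transpose_le_transpose {A B : Matrix A' A' ℂ} (hAB : A ≤ B) : Aᵀ ≤ Bᵀ := by
  rw [Matrix.le_iff, ← Matrix.transpose_sub]
  exact Matrix.PosSemidef.transpose hAB

theorem hsNormSq_mul_conjTranspose_le [Fintype E] [Fintype A'] {W φ : Matrix E A' ℂ}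
    {M : Matrix A' A' ℂ} (hWM : (Wᴴ * W)ᵀ ≤ Mᴴ * M) :
    hsNormSq (W * φᴴ) ≤ hsNormSq (φ * Mᵀ) := by
  have hle : Wᴴ * W ≤ Mᵀ * (Mᵀ)ᴴ := by
    have h := transpose_le_transpose hWM
    rwa [Matrix.transpose_transpose, Matrix.transpose_mul] at h
  have hdiff : φ * Mᵀ * (φ * Mᵀ)ᴴ - (W * φᴴ)ᴴ * (W * φᴴ) =
      φ * (Mᵀ * (Mᵀ)ᴴ - Wᴴ * W) * φᴴ := by
    simp only [Matrix.conjTranspose_mul, Matrix.conjTranspose_conjTranspose, Matrix.mul_sub,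
      Matrix.sub_mul, Matrix.mul_assoc]
  have hpos := (Matrix.PosSemidef.mul_mul_conjTranspose_same hle φ).trace_nonneg
  rw [← hdiff, Matrix.trace_sub] at hpos
  rw [← re_trace_mul_conjTranspose_self (φ * Mᵀ)]
  exact sub_nonneg.mp (Complex.nonneg_iff.mp hpos).1

variable [Fintype A'] [DecidableEq A']

theorem exists_isMeasurement_ge {F : Bits n → Matrix A' A' ℂ} (hF : ∀ e, (F e).PosSemidef)
    (hsum : ∑ e, F e ≤ 1) : ∃ M, IsMeasurement M ∧ ∀ e, F e ≤ (M e)ᴴ * M e := by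
  set F' : Bits n → Matrix A' A' ℂ := fun e => F e + if e = 0 then 1 - ∑ e, F e else 0
  have hFF' (e : Bits n) : F e ≤ F' e := by
    refine le_add_of_nonneg_right ?_
    split_ifs
    exacts [sub_nonneg.mpr hsum, le_rfl]
  have hsqrt (e : Bits n) : (CFC.sqrt (F' e))ᴴ * CFC.sqrt (F' e) = F' e := by
    rw [(posSemidef_sqrt _).1, CFC.sqrt_mul_sqrt_self _ ((hF e).nonneg.trans (hFF' e))]
  refine ⟨fun e => CFC.sqrt (F' e), ?_, fun e => (hsqrt e).symm ▸ hFF' e⟩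
  simp only [IsMeasurement, hsqrt, F', Finset.sum_add_distrib, Finset.sum_ite_eq',
    Finset.mem_univ, if_true, add_sub_cancel]

variable [Fintype E] [DecidableEq E]

theorem exists_isMeasurement_phaseErrorProb_pec_le {h : Matrix (Fin r) (Fin n) (ZMod 2)}
    {Ψ : (Bits n × E) × A' → ℂ} {ρ : Matrix (Bits n × E) (Bits n × E) ℂ}
    (hΨ : IsPurification Ψ ρ) {W : Bits n → Matrix E A' ℂ}
    (hW : ∀ s, ∑ e with h *ᵥ e = s, (W e)ᴴ * W e ≤ 1) :
    ∃ M : Bits r → Bits n → Matrix A' A' ℂ, (∀ s, IsMeasurement (M s)) ∧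
      phaseErrorProb (ptrace (ptrace (pec h M (ketbra Ψ)))) ≤ ρ.trace.re -
        ∑ e, hsNormSq (W e * (phaseComp (bitComp Ψ) e)ᴴ) := by
  have hF (s : Bits r) (e : Bits n) :
      (if h *ᵥ e = s then ((W e)ᴴ * W e)ᵀ else 0).PosSemidef := by
    split_ifs
    exacts [(Matrix.posSemidef_conjTranspose_mul_self _).transpose, Matrix.PosSemidef.zero]
  have hsum (s : Bits r) : ∑ e, (if h *ᵥ e = s then ((W e)ᴴ * W e)ᵀ else 0) ≤ 1 := by
    rw [← Finset.sum_filter, ← Matrix.transpose_sum, ← Matrix.transpose_one]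
    exact transpose_le_transpose (hW s)
  choose M hM hle using fun s => exists_isMeasurement_ge (hF s) (hsum s)
  refine ⟨M, hM, ?_⟩
  rw [phaseErrorProb_pec h M hM hΨ]
  refine sub_le_sub_left (Finset.sum_le_sum fun e _ => hsNormSq_mul_conjTranspose_le ?_) _
  have hMe := hle (h *ᵥ e) e
  rwa [if_pos rfl] at hMe

end Measurement

section Hashing

variable {n m : ℕ} {E : Type*} {q : Bits n → Matrix E E ℂ}

theorem sum_fiberSum_mul_fiberSum {ι κ N : Type*} [Fintype ι] [Fintype κ] [DecidableEq κ]
    [NonUnitalNonAssocSemiring N] (f : ι → κ) (q : ι → N) :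
    ∑ k, fiberSum f q k * fiberSum f q k = ∑ a, ∑ b, if f a = f b then q a * q b else 0 := by
  simp only [fiberSum, Finset.sum_mul_sum, Finset.sum_filter]
  refine Finset.sum_comm.trans (Finset.sum_congr rfl fun a _ => ?_)
  refine Finset.sum_comm.trans (Finset.sum_congr rfl fun b _ => ?_)
  simp only [ite_mul, zero_mul, Finset.sum_ite_eq, Finset.mem_univ, if_true, mul_ite, mul_zero]

theorem RandomHash.IsUniversal₂.sum_prob_mul_collision_le {G : RandomHash n m}
    (hG : G.IsUniversal₂) {d : Bits n → Bits n → ℝ} (hd : ∀ a b, 0 ≤ d a b) :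
    ∑ g ∈ G.family, G.prob g * ∑ a, ∑ b, (if g a = g b then d a b else 0) ≤
      ∑ a, d a a + ((2 : ℝ) ^ m)⁻¹ * ∑ a, ∑ b, d a b := by
  have hpair (a b : Bits n) : ∑ g ∈ G.family, G.prob g * (if g a = g b then 1 else 0) ≤
      (if a = b then 1 else 0) + ((2 : ℝ) ^ m)⁻¹ := by
    split_ifs with hab
    · simp only [hab, if_true, mul_one, G.prob_sum]
      exact le_add_of_nonneg_right (by positivity)
    · rw [zero_add]
      exact hG a b hab
  calc ∑ g ∈ G.family, G.prob g * ∑ a, ∑ b, (if g a = g b then d a b else 0)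
      = ∑ a, ∑ b, (∑ g ∈ G.family, G.prob g * (if g a = g b then 1 else 0)) * d a b := by
        simp only [Finset.mul_sum, Finset.sum_mul]
        rw [Finset.sum_comm]
        refine Finset.sum_congr rfl fun a _ => ?_
        rw [Finset.sum_comm]
        simp only [mul_assoc, ite_mul, one_mul, zero_mul]
    _ ≤ ∑ a, ∑ b, ((if a = b then 1 else 0) + ((2 : ℝ) ^ m)⁻¹) * d a b :=
        Finset.sum_le_sum fun a _ => Finset.sum_le_sum fun b _ =>
          mul_le_mul_of_nonneg_right (hpair a b) (hd a b)
    _ = ∑ a, d a a + ((2 : ℝ) ^ m)⁻¹ * ∑ a, ∑ b, d a b := by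
        simp only [add_mul, Finset.sum_add_distrib, ite_mul, one_mul, zero_mul,
          Finset.sum_ite_eq, Finset.mem_univ, if_true, Finset.mul_sum]

variable [Fintype E] [DecidableEq E] {R : Matrix E E ℂ}

theorem sum_prob_mul_trace_whiten_fiberSum_le {G : RandomHash n m} (hG : G.IsUniversal₂)
    (hq : ∀ a, (q a).PosSemidef) (hR : R.IsHermitian) (hsum : ∑ a, q a = R ^ 4) :
    ∑ g ∈ G.family, G.prob g * ∑ k, (whiten R (fiberSum g q k) ^ 2).trace.re ≤
      ∑ a, (whiten R (q a) ^ 2).trace.re + ((2 : ℝ) ^ m)⁻¹ * (R ^ 4).trace.re := by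
  set d : Bits n → Matrix E E ℂ := fun a => whiten R (q a)
  have hfiber (g : Bits n →ₗ[ZMod 2] Bits m) :
      ∑ k, (whiten R (fiberSum g q k) ^ 2).trace.re =
        ∑ a, ∑ b, if g a = g b then (d a * d b).trace.re else 0 := by
    have hwhiten (k : Bits m) : whiten R (fiberSum g q k) = fiberSum g d k := whiten_sum _ _
    simp only [hwhiten, ← Complex.re_sum, ← Matrix.trace_sum, pow_two, sum_fiberSum_mul_fiberSum]
    simp only [Matrix.trace_sum, Complex.re_sum, apply_ite Matrix.trace, apply_ite Complex.re,
      Matrix.trace_zero, Complex.zero_re]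
  have htotal : ∑ a, ∑ b, (d a * d b).trace.re = (R ^ 4).trace.re := by
    simp only [← Complex.re_sum, ← Matrix.trace_sum, ← Finset.sum_mul_sum, d, ← whiten_sum, hsum,
      whiten_pow_four hR, ← pow_add]
  have hd (a b : Bits n) : 0 ≤ (d a * d b).trace.re :=
    re_trace_mul_nonneg (posSemidef_whiten (hq a)) (posSemidef_whiten (hq b))
  simp only [hfiber, ← htotal]
  simpa only [pow_two] using hG.sum_prob_mul_collision_le hd

end Hashing

section MinEntropy

variable {ι E : Type*} [Fintype ι] [DecidableEq ι] [Fintype E]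
  {ρ : Matrix (ι × E) (ι × E) ℂ} {q : ι → Matrix E E ℂ}

omit [DecidableEq ι] in
theorem sum_re_trace_whiten_sq_le [DecidableEq E] {R : Matrix E E ℂ} (hR : R.IsHermitian)
    (hq : ∀ a, (q a).PosSemidef) (hsum : ∑ a, q a = R ^ 4) {σ : Matrix E E ℂ}
    (hσ : IsNormalized σ) {c : ℝ} (hc : 0 ≤ c) (hqσ : ∀ a, q a ≤ (c : ℂ) • σ) :
    ∑ a, (whiten R (q a) ^ 2).trace.re ≤ c := by
  have hpointwise (a : ι) : (whiten R (q a) ^ 2).trace.re ≤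
      c * (σ * whiten R (whiten R (q a))).trace.re := by
    have h := re_trace_mul_nonneg (hqσ a)
      (posSemidef_whiten (R := R) (posSemidef_whiten (R := R) (hq a)))
    rw [Matrix.sub_mul, Matrix.smul_mul, Matrix.trace_sub, Matrix.trace_smul, smul_eq_mul,
      Complex.sub_re, Complex.re_ofReal_mul] at h
    rw [pow_two, trace_whiten_mul_whiten]
    exact sub_nonneg.mp h
  have hsupport : ∑ a, (σ * whiten R (whiten R (q a))).trace.re ≤ 1 := by
    have h := re_trace_mul_nonneg hσ.1
      (Matrix.nonneg_iff_posSemidef.mp (isStarProjection_supportProj hR).one_sub.nonneg)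
    rw [Matrix.mul_sub, Matrix.mul_one, Matrix.trace_sub, hσ.2, Complex.sub_re, Complex.one_re]
      at h
    rw [← Complex.re_sum, ← Matrix.trace_sum, ← Matrix.mul_sum, ← whiten_sum, ← whiten_sum, hsum,
      whiten_pow_four hR, whiten_sq hR]
    exact sub_nonneg.mp h
  calc ∑ a, (whiten R (q a) ^ 2).trace.re
      ≤ ∑ a, c * (σ * whiten R (whiten R (q a))).trace.re :=
        Finset.sum_le_sum fun a _ => hpointwise a
    _ ≤ c := by
        rw [← Finset.mul_sum]
        exact mul_le_of_le_one_right hc hsupport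

omit [Fintype ι] in
theorem posSemidef_single (a : ι) : (Matrix.single a a (1 : ℂ)).PosSemidef := by
  rw [← Matrix.diagonal_single]
  exact Matrix.PosSemidef.diagonal (Pi.single_nonneg.mpr zero_le_one)

omit [Fintype E] in
theorem cq_submatrix (hρ : ρ = ∑ a, Matrix.single a a (1 : ℂ) ⊗ₖ q a) (a : ι) :
    ρ.submatrix (Prod.mk a) (Prod.mk a) = q a := by
  ext e f
  simp [hρ, Matrix.sum_apply, Matrix.single_apply]

theorem trace_cq (hρ : ρ = ∑ a, Matrix.single a a (1 : ℂ) ⊗ₖ q a) :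
    ρ.trace = (∑ a, q a).trace := by
  simp [hρ, Matrix.trace_sum, Matrix.trace_kronecker]

omit [Fintype E] in
theorem le_smul_of_cq_le (hρ : ρ = ∑ a, Matrix.single a a (1 : ℂ) ⊗ₖ q a) {c : ℂ}
    {σ : Matrix E E ℂ} (hle : ρ ≤ c • ((1 : Matrix ι ι ℂ) ⊗ₖ σ)) (a : ι) : q a ≤ c • σ := by
  have h := Matrix.PosSemidef.submatrix hle (Prod.mk a)
  rw [Matrix.submatrix_sub, Pi.sub_apply, Pi.sub_apply, cq_submatrix hρ] at h
  have hblock : (c • ((1 : Matrix ι ι ℂ) ⊗ₖ σ)).submatrix (Prod.mk a) (Prod.mk a) = c • σ := by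
    ext e f
    simp
  rwa [hblock] at h

omit [Fintype E] in
theorem cq_le_one_kronecker_sum [Finite E] (hρ : ρ = ∑ a, Matrix.single a a (1 : ℂ) ⊗ₖ q a)
    (hq : ∀ a, (q a).PosSemidef) : ρ ≤ (1 : Matrix ι ι ℂ) ⊗ₖ ∑ a, q a := by
  have := Fintype.ofFinite E
  rw [hρ, ← Matrix.sum_single_one, sum_kronecker]
  refine Finset.sum_le_sum fun a _ => ?_
  have hrest : ∑ b, q b = ∑ b ∈ Finset.univ.erase a, q b + q a :=
    (Finset.sum_erase_add _ _ (Finset.mem_univ a)).symm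
  rw [hrest, Matrix.kronecker_add, le_add_iff_nonneg_left]
  exact ((posSemidef_single a).kronecker (Matrix.posSemidef_sum _ fun b _ => hq b)).nonneg

theorem exists_isNormalized_smul_eq {S : Matrix E E ℂ} (hS : S.PosSemidef) (hS0 : S ≠ 0) :
    ∃ x : ℝ, 0 < x ∧ ∃ σ, IsNormalized σ ∧ S = (x : ℂ) • σ := by
  have htrace : 0 < S.trace :=
    hS.trace_nonneg.lt_of_ne fun h => hS0 (hS.trace_eq_zero_iff.mp h.symm)
  obtain ⟨x, hx⟩ : ∃ x : ℝ, (x : ℂ) = S.trace :=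
    ⟨_, Complex.conj_eq_iff_re.mp (Complex.conj_eq_iff_im.mpr (Complex.pos_iff.mp htrace).2.symm)⟩
  have hx0 : 0 < x := by rwa [← hx, Complex.zero_lt_real] at htrace
  have hx0' : (x : ℂ) ≠ 0 := by exact_mod_cast hx0.ne'
  refine ⟨x, hx0, ((x⁻¹ : ℝ) : ℂ) • S, ⟨hS.smul ?_, ?_⟩, ?_⟩
  · exact_mod_cast (inv_pos.mpr hx0).le
  · rw [Matrix.trace_smul, ← hx, smul_eq_mul, Complex.ofReal_inv, inv_mul_cancel₀ hx0']
  · rw [smul_smul, Complex.ofReal_inv, mul_inv_cancel₀ hx0', one_smul]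

theorem minEntropySet_nonempty (hρ : ρ = ∑ a, Matrix.single a a (1 : ℂ) ⊗ₖ q a)
    (hq : ∀ a, (q a).PosSemidef) (hρ0 : ρ ≠ 0) : (minEntropySet ρ).Nonempty := by
  have hle := cq_le_one_kronecker_sum hρ hq
  have hρnonneg : 0 ≤ ρ := hρ ▸
    Finset.sum_nonneg fun a _ => ((posSemidef_single a).kronecker (hq a)).nonneg
  have hsum0 : ∑ a, q a ≠ 0 := fun h => hρ0 <| by
    rw [h, Matrix.kronecker_zero] at hle
    exact le_antisymm hle hρnonneg
  obtain ⟨x, hx, σ, hσ, hqσ⟩ :=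
    exists_isNormalized_smul_eq (Matrix.posSemidef_sum _ fun a _ => hq a) hsum0
  refine ⟨-Real.logb 2 x, σ, hσ, ?_⟩
  rw [neg_neg, Real.rpow_logb two_pos (by norm_num) hx, ← Matrix.kronecker_smul, ← hqσ]
  exact hle

theorem le_two_rpow_neg_csSup {B : ℝ} {L : Set ℝ} (hL : L.Nonempty)
    (hB : ∀ l ∈ L, B ≤ (2 : ℝ) ^ (-l)) : B ≤ (2 : ℝ) ^ (-sSup L) := by
  rcases le_or_gt B 0 with hB0 | hB0
  · exact hB0.trans (by positivity)
  rw [← Real.logb_le_iff_le_rpow one_lt_two hB0, le_neg]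
  exact csSup_le hL fun l hl =>
    le_neg.mp ((Real.logb_le_iff_le_rpow one_lt_two hB0).mpr (hB l hl))

theorem sum_re_trace_whiten_sq_le_two_rpow_neg_minEntropy [DecidableEq E] {R : Matrix E E ℂ}
    (hρ : ρ = ∑ a, Matrix.single a a (1 : ℂ) ⊗ₖ q a) (hρ0 : ρ ≠ 0) (hR : R.IsHermitian)
    (hq : ∀ a, (q a).PosSemidef) (hsum : ∑ a, q a = R ^ 4) :
    ∑ a, (whiten R (q a) ^ 2).trace.re ≤ (2 : ℝ) ^ (-minEntropy ρ) := by
  refine le_two_rpow_neg_csSup (minEntropySet_nonempty hρ hq hρ0) ?_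
  rintro l ⟨σ, hσ, hle⟩
  exact sum_re_trace_whiten_sq_le hR hq hsum hσ (by positivity) (le_smul_of_cq_le hρ hle)

end MinEntropy

section CodingTheorem

variable {n m r : ℕ} {E A' : Type*} [Fintype E] [DecidableEq E] [Fintype A'] [DecidableEq A']
  {ρ : Matrix (Bits n × E) (Bits n × E) ℂ} {q : Bits n → Matrix E E ℂ} {R : Matrix E E ℂ}
  {Ψ : (Bits n × E) × A' → ℂ}

theorem exists_isMeasurement_phaseErrorProb_pec_le_collision
    (hρ : ρ = ∑ a, Matrix.single a a (1 : ℂ) ⊗ₖ q a) (hq : ∀ a, (q a).PosSemidef)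
    (hR : R.PosSemidef) (hsum : ∑ a, q a = R ^ 4) (hΨ : IsPurification Ψ ρ)
    {g : Bits n →ₗ[ZMod 2] Bits m} (hg : Function.Surjective g)
    {h : Matrix (Fin r) (Fin n) (ZMod 2)} (hh : IsCheckMatrix h (code g)) :
    ∃ M : Bits r → Bits n → Matrix A' A' ℂ, (∀ s, IsMeasurement (M s)) ∧
      phaseErrorProb (ptrace (ptrace (pec h M (ketbra Ψ)))) ≤
        2 ^ m * ∑ k, (whiten R (fiberSum g q k) ^ 2).trace.re - (R ^ 4).trace.re := by
  have hT := isEnsemblePurification_bitComp hΨ hρ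
  obtain ⟨M, hM, hle⟩ := exists_isMeasurement_phaseErrorProb_pec_le hΨ
    (sum_filter_phaseDecoder_le_one (R := R) hq hT hg hh)
  have hdecoder := two_mul_re_trace_le_phaseDecoder (g := g) hq hT hsum hR
  refine ⟨M, hM, hle.trans ?_⟩
  rw [trace_cq hρ, hsum]
  linarith

theorem RandomHash.IsUniversal₂.sum_prob_mul_le {G : RandomHash n m} (hG : G.IsUniversal₂)
    (hρ : ρ = ∑ a, Matrix.single a a (1 : ℂ) ⊗ₖ q a) (hρ0 : ρ ≠ 0) (hq : ∀ a, (q a).PosSemidef)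
    (hR : R.IsHermitian) (hsum : ∑ a, q a = R ^ 4) :
    ∑ g ∈ G.family, G.prob g *
        (2 ^ m * ∑ k, (whiten R (fiberSum g q k) ^ 2).trace.re - (R ^ 4).trace.re) ≤
      (2 : ℝ) ^ ((m : ℝ) - minEntropy ρ) := by
  have hcollision := sum_prob_mul_trace_whiten_fiberSum_le hG hq hR hsum
  have hentropy := sum_re_trace_whiten_sq_le_two_rpow_neg_minEntropy hρ hρ0 hR hq hsum
  calc ∑ g ∈ G.family, G.prob g *
          (2 ^ m * ∑ k, (whiten R (fiberSum g q k) ^ 2).trace.re - (R ^ 4).trace.re)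
      = 2 ^ m * ∑ g ∈ G.family, G.prob g * ∑ k, (whiten R (fiberSum g q k) ^ 2).trace.re -
          (R ^ 4).trace.re := by
        simp only [mul_sub, Finset.sum_sub_distrib, ← Finset.sum_mul, G.prob_sum, one_mul,
          mul_left_comm, ← Finset.mul_sum]
    _ ≤ 2 ^ m * (∑ a, (whiten R (q a) ^ 2).trace.re + ((2 : ℝ) ^ m)⁻¹ * (R ^ 4).trace.re) -
          (R ^ 4).trace.re := by gcongr
    _ = 2 ^ m * ∑ a, (whiten R (q a) ^ 2).trace.re := by
        rw [mul_add, mul_inv_cancel_left₀ (by positivity), add_sub_cancel_right]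
    _ ≤ 2 ^ m * (2 : ℝ) ^ (-minEntropy ρ) := by gcongr
    _ = (2 : ℝ) ^ ((m : ℝ) - minEntropy ρ) := by
        rw [sub_eq_add_neg, Real.rpow_add two_pos, Real.rpow_natCast]

end CodingTheorem

end PhaseEC

end

theorem mainTheorem1_general {n m r : ℕ} {E A' : Type*}
    [Fintype E] [DecidableEq E] [Fintype A'] [DecidableEq A']
    (ρ : Matrix (PhaseEC.Bits n × E) (PhaseEC.Bits n × E) ℂ)
    (hcq : PhaseEC.IsCQ ρ) (hρ0 : ρ ≠ 0)
    (Ψ : (PhaseEC.Bits n × E) × A' → ℂ) (hΨ : PhaseEC.IsPurification Ψ ρ)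
    (G : PhaseEC.RandomHash n m) (hG : G.IsUniversal₂)
    (h : (PhaseEC.Bits n →ₗ[ZMod 2] PhaseEC.Bits m) → Matrix (Fin r) (Fin n) (ZMod 2))
    (hh : ∀ g ∈ G.family, PhaseEC.IsCheckMatrix (h g) (PhaseEC.code g)) :
    ∃ M : (PhaseEC.Bits n →ₗ[ZMod 2] PhaseEC.Bits m) → PhaseEC.Bits r →
        PhaseEC.Bits n → Matrix A' A' ℂ,
      (∀ g ∈ G.family, ∀ s, PhaseEC.IsMeasurement (M g s)) ∧
      ∑ g ∈ G.family, G.prob g *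
          PhaseEC.phaseErrorProb
            (PhaseEC.ptrace (PhaseEC.ptrace
              (PhaseEC.pec (h g) (M g) (PhaseEC.ketbra Ψ))))
        ≤ (2 : ℝ) ^ ((m : ℝ) - PhaseEC.minEntropy ρ) := by
  obtain ⟨q, hq, hρq⟩ := hcq
  obtain ⟨R, hR, hRq⟩ :=
    PhaseEC.exists_posSemidef_pow_four_eq (Matrix.posSemidef_sum Finset.univ fun a _ => hq a)
  choose! M hM hle using fun g hg =>
    PhaseEC.exists_isMeasurement_phaseErrorProb_pec_le_collision hρq hq hR hRq.symm hΨ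
      (G.surjective g hg) (hh g hg)
  refine ⟨M, hM, le_trans (Finset.sum_le_sum fun g hg => ?_)
    (hG.sum_prob_mul_le hρq hρ0 hq hR.1 hRq.symm)⟩
  exact mul_le_mul_of_nonneg_left (hle g hg) (G.prob_nonneg g hg)

theorem mainTheorem1 {n m : ℕ} {E A' : Type*}
    [Fintype E] [DecidableEq E] [Fintype A'] [DecidableEq A']
    -- the initial nonzero sub-normalized cq state on `A ⊗ E` and a purification on `A ⊗ E ⊗ A'`
    (ρ : Matrix (PhaseEC.Bits n × E) (PhaseEC.Bits n × E) ℂ)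
    (hρ : PhaseEC.IsSubnormalized ρ) (hcq : PhaseEC.IsCQ ρ) (hρ0 : ρ ≠ 0)
    (Ψ : (PhaseEC.Bits n × E) × A' → ℂ) (hΨ : PhaseEC.IsPurification Ψ ρ)
    -- the random hash function and a check matrix of the code `(ker g)^⊥` for each `g`
    (G : PhaseEC.RandomHash n m) (hG : G.IsUniversal₂)
    (h : (PhaseEC.Bits n →ₗ[ZMod 2] PhaseEC.Bits m) → Matrix (Fin (n - m)) (Fin n) (ZMod 2))
    (hh : ∀ g ∈ G.family, PhaseEC.IsCheckMatrix (h g) (PhaseEC.code g)) :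
    -- the ancilla measurements, depending on `g` and on the syndrome `s`
    ∃ M : (PhaseEC.Bits n →ₗ[ZMod 2] PhaseEC.Bits m) → PhaseEC.Bits (n - m) →
        PhaseEC.Bits n → Matrix A' A' ℂ,
      (∀ g ∈ G.family, ∀ s, PhaseEC.IsMeasurement (M g s)) ∧
      ∑ g ∈ G.family, G.prob g *
          PhaseEC.phaseErrorProb
            (PhaseEC.ptrace (PhaseEC.ptrace
              (PhaseEC.pec (h g) (M g) (PhaseEC.ketbra Ψ))))
        ≤ (2 : ℝ) ^ ((m : ℝ) - PhaseEC.minEntropy ρ) :=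
  mainTheorem1_general ρ hcq hρ0 Ψ hΨ G hG h hh
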